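/- Let $\Phi$ be a reduced irreducible (crystallographic) root system of rank $r$ in a real $r$-dimensional vector space $V$, with Weyl group $W$; that is, $\Phi$ is a finite set of nonzero vectors spanning $V$, stable under the reflections $s_\alpha(v)=v-\langle v,\alpha^\vee\rangle\alpha$ ($\alpha\in\Phi$), with all $\langle\beta,\alpha^\vee\rangle\in\mathbb Z$, and $W$ is generated by these reflections. Let $\Delta\subseteq\Phi$ be a set of simple roots (a base of $\Phi$) and let $\Delta_0\subseteq\Delta$ be a nonempty set consisting of $s$ pairwise orthogonal roots. Then there exist a natural number $t$ and elements $w_1,\dots,w_t\in W$ such that 1. $w_1(\Delta_0)\cup\dots\cup w_t(\Delta_0)$ spans the vector space $V$, and 2. $t\le \dfrac{2r}{s}+3$. -/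

import Mathlib

/-!
The `⌈r / s⌉` translates needed to reach dimension `r` are chosen greedily: each new translate can
be made to contribute as many dimensions as is at all possible. Let `E` be the span of the roots
in `Δ₀` and `U` the span of the translates chosen so far. The claim is that for some `w` in the Weyl
group `U + wE` is everything or `U ∩ wE = 0`
(`RootPairing.exists_weylGroup_sup_eq_top_or_disjoint`).

Choose `w` such that `U + wE` has maximal dimension. If `A = U + wE` is a proper subspace and
`0 ≠ x ∈ U ∩ wE`, there is a root `β` outside `A` which is not orthogonal to `x`, because the coroots
of the roots outside a proper subspace span (`RootPairing.span_coroot_notMem_eq_top`, where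
irreducibility enters). Now `U + s_β wE` contains `x` and `s_β x`, whence `β`, whence also `wE`.
It is therefore strictly larger than `A`, which contradicts maximality.

The argument works for an arbitrary subspace `E`. Applied to the span of linearly independent roots,
it yields the bound `r / s + 1` on the number of translates.
-/

namespace RootPairing

open Module Submodule

variable {ι K M N : Type*} [Field K] [NeZero (2 : K)] [AddCommGroup M] [Module K M]
  [AddCommGroup N] [Module K N] (P : RootPairing ι K M N) [P.IsRootSystem] [P.IsIrreducible]

/-- If a root `α` in `A` is not orthogonal to a root `β` outside `A`, then `s_α β` is also outside
`A`, so the coroot of `α` lies in the span of those of `β` and `s_α β`. Hence any coroot outside the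
span is orthogonal to the span, and irreducibility applies. -/
lemma span_coroot_notMem_eq_top {A : Submodule K M} (hA : A ≠ ⊤) :
    span K (P.coroot '' {i | P.root i ∉ A}) = ⊤ := by
  have hne : {i | P.root i ∉ A}.Nonempty := by
    by_contra! h
    refine hA (top_le_iff.mp ?_)
    rw [← IsRootSystem.span_root_eq_top (P := P), span_le]
    rintro - ⟨i, rfl⟩
    by_contra hi
    exact Set.eq_empty_iff_forall_notMem.mp h i hi
  refine P.flip.span_root_image_eq_top_of_forall_orthogonal _ hne fun j hj i hi ↦ ?_
  by_contra hij
  have hij₀ : P.pairing i j ≠ 0 := fun h ↦ hij ⟨h, P.pairing_eq_zero_iff'.mp h⟩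
  have hji₀ : P.pairing j i ≠ 0 := fun h ↦ hij₀ (P.pairing_eq_zero_iff'.mp h)
  refine hj ?_
  by_cases hjA : P.root j ∈ A
  · have hk : P.root (P.reflectionPerm j i) ∉ A := by
      rw [root_reflectionPerm, reflection_apply_root]
      exact fun h ↦ hi ((A.sub_mem_iff_left (A.smul_mem _ hjA)).mp h)
    have h₁ : P.coroot i ∈ span K (P.coroot '' {i | P.root i ∉ A}) :=
      subset_span ⟨i, hi, rfl⟩
    have h₂ : P.coroot (P.reflectionPerm j i) ∈ span K (P.coroot '' {i | P.root i ∉ A}) :=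
      subset_span ⟨_, hk, rfl⟩
    rw [coroot_reflectionPerm, coreflection_apply_coroot, sub_mem_iff_right _ h₁] at h₂
    exact (smul_mem_iff _ hji₀).mp h₂
  · exact subset_span ⟨j, hjA, rfl⟩

lemma exists_root_notMem_and_coroot'_ne_zero {A : Submodule K M} (hA : A ≠ ⊤) {x : M}
    (hx : x ≠ 0) : ∃ i, P.root i ∉ A ∧ P.coroot' i x ≠ 0 := by
  by_contra! h
  have hker : span K (P.coroot '' {i | P.root i ∉ A}) ≤ LinearMap.ker (P.toLinearMap x) := by
    rw [span_le]
    rintro - ⟨i, hi, rfl⟩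
    exact h i hi
  rw [P.span_coroot_notMem_eq_top hA] at hker
  exact hx (P.eq_zero_iff_forall_coroot'_eq_zero.mpr fun i ↦ hker mem_top)

/-- Any subspace `E` has a translate under the Weyl group in general position with respect to a
given subspace `U`. -/
lemma exists_weylGroup_sup_eq_top_or_disjoint [FiniteDimensional K M] (U E : Submodule K M) :
    ∃ w : P.weylGroup, U ⊔ E.map (P.weylGroupRootRep w) = ⊤ ∨
      Disjoint U (E.map (P.weylGroupRootRep w)) := by
  let f (w : P.weylGroup) : ℕ := finrank K ↥(U ⊔ E.map (P.weylGroupRootRep w))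
  have hbdd : BddAbove (Set.range f) :=
    ⟨finrank K M, by rintro - ⟨w, rfl⟩; exact Submodule.finrank_le _⟩
  obtain ⟨w, hw⟩ : ∃ w, f w = sSup (Set.range f) := Nat.sSup_mem (Set.range_nonempty f) hbdd
  have hmax (w' : P.weylGroup) : f w' ≤ f w := hw ▸ le_csSup hbdd ⟨w', rfl⟩
  refine ⟨w, ?_⟩
  by_contra! h
  obtain ⟨htop, hdisj⟩ := h
  obtain ⟨x, hx, hx₀⟩ := exists_mem_ne_zero_of_ne_bot (disjoint_iff.not.mp hdisj)
  obtain ⟨i, hi, hix⟩ := P.exists_root_notMem_and_coroot'_ne_zero htop hx₀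
  set E₁ := E.map (P.weylGroupRootRep w)
  set E₂ := E.map (P.weylGroupRootRep (weylGroup.ofIdx P i * w))
  -- The reflection of `y` in the root `i` lies in `E₂`.
  have hrefl {y : M} (hy : y ∈ E₁) : y - P.coroot' i y • P.root i ∈ U ⊔ E₂ := by
    obtain ⟨e, he, rfl⟩ := hy
    refine mem_sup_right ⟨e, he, ?_⟩
    rw [map_mul]
    rfl
  have hroot : P.root i ∈ U ⊔ E₂ := by
    have := hrefl hx.2
    rw [sub_mem_iff_right _ (mem_sup_left hx.1)] at this
    exact (smul_mem_iff _ hix).mp this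
  have hlt : U ⊔ E₁ < U ⊔ E₂ := by
    refine lt_of_le_of_ne (sup_le le_sup_left fun y hy ↦ ?_) fun h ↦ hi (h ▸ hroot)
    exact (sub_mem_iff_left _ (smul_mem _ _ hroot)).mp (hrefl hy)
  exact (hmax (weylGroup.ofIdx P i * w)).not_gt (finrank_lt_finrank_of_lt hlt)

/-- The dimension of a sum of `n` Weyl group translates of `E` can be made as large as possible. -/
lemma exists_weylGroup_min_le_finrank_iSup [FiniteDimensional K M] (E : Submodule K M) (n : ℕ) :
    ∃ w : Fin n → P.weylGroup, min (finrank K M) (n * finrank K E) ≤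
      finrank K ↥(⨆ k, E.map (P.weylGroupRootRep (w k))) := by
  induction n with
  | zero => exact ⟨Fin.elim0, by simp⟩
  | succ n ih =>
    obtain ⟨w, hw⟩ := ih
    set U := ⨆ k, E.map (P.weylGroupRootRep (w k))
    obtain ⟨w₀, hw₀⟩ := P.exists_weylGroup_sup_eq_top_or_disjoint U E
    refine ⟨Fin.cons w₀ w, ?_⟩
    have hsup : ⨆ k, E.map (P.weylGroupRootRep ((Fin.cons w₀ w : Fin (n + 1) → P.weylGroup) k)) =
        U ⊔ E.map (P.weylGroupRootRep w₀) := by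
      refine le_antisymm (iSup_le fun k ↦ ?_) (sup_le (iSup_le fun k ↦ ?_) ?_)
      · cases k using Fin.cases with
        | zero => exact le_sup_right
        | succ k => exact (le_iSup (fun k ↦ E.map (P.weylGroupRootRep (w k))) k).trans le_sup_left
      · exact le_iSup_of_le k.succ le_rfl
      · exact le_iSup_of_le 0 le_rfl
    rw [hsup]
    rcases hw₀ with h | h
    · rw [h, finrank_top]
      exact min_le_left _ _
    · have hadd := finrank_sup_add_finrank_inf_eq U (E.map (P.weylGroupRootRep w₀))
      have hE : finrank K (E.map (P.weylGroupRootRep w₀)) = finrank K E :=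
        (E.equivMapOfInjective _ (MulAction.injective w₀)).symm.finrank_eq
      rw [h.eq_bot, finrank_bot, hE] at hadd
      rw [add_mul, one_mul]
      omega

end RootPairing

theorem mainTheorem11 {ι V N : Type*} [Finite ι]
    [AddCommGroup V] [Module ℝ V] [AddCommGroup N] [Module ℝ N]
    (Φ : RootPairing ι ℝ V N) [Φ.IsRootSystem] [Φ.IsCrystallographic]
    [Φ.IsReduced] [Φ.IsIrreducible]
    (Δ : Φ.Base) (Δ₀ : Finset ι) (hsub : Δ₀ ⊆ Δ.support) (hne : Δ₀.Nonempty)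
    (horth : (Δ₀ : Set ι).Pairwise (fun i j => Φ.IsOrthogonal i j)) :
    ∃ (t : ℕ) (w : Fin t → Φ.weylGroup),
      Submodule.span ℝ (⋃ k : Fin t, (fun v : V => w k • v) '' (Φ.root '' (Δ₀ : Set ι))) = ⊤ ∧
      (t : ℝ) ≤ 2 * (Module.finrank ℝ V : ℝ) / (Δ₀.card : ℝ) + 3 := by
  have : FiniteDimensional ℝ V :=
    ⟨by
      rw [← RootPairing.IsRootSystem.span_root_eq_top (P := Φ)]
      exact Submodule.fg_span (Set.finite_range _)⟩
  set E := Submodule.span ℝ (Φ.root '' (Δ₀ : Set ι))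
  have hE : Module.finrank ℝ E = Δ₀.card := by
    have h := finrank_span_eq_card (Δ.linearIndepOn_root.mono (Finset.coe_subset.mpr hsub))
    rw [← Set.image_eq_range] at h
    simpa using h
  have hs : (0 : ℝ) < Δ₀.card := by exact_mod_cast hne.card_pos
  have hr : (0 : ℝ) ≤ Module.finrank ℝ V / Δ₀.card := by positivity
  obtain ⟨w, hw⟩ := Φ.exists_weylGroup_min_le_finrank_iSup E
    ⌈(Module.finrank ℝ V : ℝ) / Δ₀.card⌉₊
  refine ⟨_, w, ?_, ?_⟩
  · have hspan : Submodule.span ℝ (⋃ k, (fun v : V => w k • v) '' (Φ.root '' (Δ₀ : Set ι))) =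
        ⨆ k, E.map (Φ.weylGroupRootRep (w k)) := by
      rw [Submodule.span_iUnion]
      exact iSup_congr fun k ↦ (Submodule.map_span (Φ.weylGroupRootRep (w k)) _).symm
    have hle : Module.finrank ℝ V ≤
        ⌈(Module.finrank ℝ V : ℝ) / Δ₀.card⌉₊ * Module.finrank ℝ E := by
      rw [hE]
      exact_mod_cast (div_le_iff₀ hs).mp (Nat.le_ceil ((Module.finrank ℝ V : ℝ) / Δ₀.card))
    rw [min_eq_left hle] at hw
    rw [hspan]
    exact Submodule.eq_top_of_finrank_eq (le_antisymm (Submodule.finrank_le _) hw)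
  · have := (Nat.ceil_lt_add_one hr).le
    rw [mul_div_assoc]
    linarith
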